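/- A state on $\mathbb C^2\otimes\mathbb C^2$ (a two-qubit state) is a positive semidefinite $4\times4$ matrix of trace $1$; it is separable if it is a finite convex combination of product states $A\otimes B$ of one-qubit states $A,B$, and entangled otherwise. For a two-qubit state $\rho$ let $\lambda_1\ge\lambda_2\ge\lambda_3\ge\lambda_4\ge 0$ be the square roots of the eigenvalues, counted with algebraic multiplicity, of $\rho(\sigma_y\otimes\sigma_y)\rho^*(\sigma_y\otimes\sigma_y)$, where $\sigma_y=\begin{pmatrix}0&-i\\ i&0\end{pmatrix}$ and $\rho^*$ is the entrywise complex conjugate in the standard product basis. Put $\Lambda(\rho)=\lambda_1-\lambda_2-\lambda_3-\lambda_4$ and let $C(\rho)=\max\{\Lambda(\rho),0\}$ be the concurrence. For a separable two-qubit state $\rho$ define the negative entanglement $$N(\rho)=-\inf\Bigl\{\,t\,C(\sigma)\;:\;t>0,\ \sigma\text{ an entangled two-qubit state},\ C\Bigl(\frac{\rho+t\sigma}{1+t}\Bigr)>0\Bigr\}.$$ The state $\rho$ is called an edge state of separable states if for every $\varepsilon>0$ there exists an entangled two-qubit state $\sigma$ such that $(\rho+\varepsilon\sigma)/(1+\varepsilon)$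 is entangled. Corollary 1. A separable two-qubit state $\rho$ is an edge state of separable states if and only if $N(\rho)=0$. -/

import Mathlib

open scoped Kronecker ComplexOrder

noncomputable section

namespace TwoQubit

/-- A quantum state (density matrix): positive semidefinite with unit trace. -/
def IsState {ι : Type*} [Fintype ι] (ρ : Matrix ι ι ℂ) : Prop :=
  ρ.PosSemidef ∧ ρ.trace = 1

/-- A bipartite state is separable if it is a finite convex combination of product states. -/
def IsSeparable {ι κ : Type*} [Fintype ι] [Fintype κ] (ρ : Matrix (ι × κ) (ι × κ) ℂ) : Prop :=
  ∃ (n : ℕ) (p : Fin n → ℝ) (A : Fin n → Matrix ι ι ℂ) (B : Fin n → Matrix κ κ ℂ),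
    (∀ i, 0 ≤ p i) ∧ ∑ i, p i = 1 ∧ (∀ i, IsState (A i)) ∧ (∀ i, IsState (B i)) ∧
      ρ = ∑ i, p i • (A i ⊗ₖ B i)

/-- A bipartite state is entangled if it is not separable. -/
def IsEntangled {ι κ : Type*} [Fintype ι] [Fintype κ] (ρ : Matrix (ι × κ) (ι × κ) ℂ) : Prop :=
  IsState ρ ∧ ¬ IsSeparable ρ

/-- The normalized mixture `(ρ + t σ) / (1 + t)`. -/
def mix {ι : Type*} (t : ℝ) (ρ σ : Matrix ι ι ℂ) : Matrix ι ι ℂ :=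
  (1 + t)⁻¹ • (ρ + t • σ)

/-- Edge states of separable states. -/
def IsEdgeState {ι κ : Type*} [Fintype ι] [Fintype κ] (ρ : Matrix (ι × κ) (ι × κ) ℂ) : Prop :=
  IsSeparable ρ ∧ ∀ ε : ℝ, 0 < ε → ∃ σ : Matrix (ι × κ) (ι × κ) ℂ,
    IsEntangled σ ∧ IsEntangled (mix ε ρ σ)

/-- Operators on the two-qubit space `ℂ² ⊗ ℂ²`, in the computational product basis. -/
abbrev Op : Type := Matrix (Fin 2 × Fin 2) (Fin 2 × Fin 2) ℂ

/-- The Pauli matrix `σ_y`. -/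
def pauliY : Matrix (Fin 2) (Fin 2) ℂ := !![0, -Complex.I; Complex.I, 0]

/-- The matrix `ρ (σ_y ⊗ σ_y) ρ* (σ_y ⊗ σ_y)`, where `ρ*` is the entrywise complex conjugate. -/
def spinFlipProduct (ρ : Op) : Op :=
  ρ * (pauliY ⊗ₖ pauliY) * ρ.map (starRingEnd ℂ) * (pauliY ⊗ₖ pauliY)

/-- The square roots of the eigenvalues of `spinFlipProduct ρ`, with algebraic multiplicity, in
decreasing order. For a state `ρ` these eigenvalues are real and nonnegative. -/
def lambdaList (ρ : Op) : List ℝ :=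
  ((spinFlipProduct ρ).charpoly.roots.map fun z => √z.re).sort (· ≥ ·)

/-- There are exactly four numbers in the list. -/
theorem length_lambdaList (ρ : Op) : (lambdaList ρ).length = 4 := by
  unfold lambdaList
  rw [Multiset.length_sort, Multiset.card_map, IsAlgClosed.card_roots_eq_natDegree,
    Matrix.charpoly_natDegree_eq_dim]
  simp

/-- `lam ρ 0 ≥ lam ρ 1 ≥ lam ρ 2 ≥ lam ρ 3` are the entries of `lambdaList ρ`. -/
def lam (ρ : Op) (i : Fin 4) : ℝ :=
  (lambdaList ρ).get (Fin.cast (length_lambdaList ρ).symm i)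

/-- `Λ(ρ) = λ₁ - λ₂ - λ₃ - λ₄`. -/
def Lam (ρ : Op) : ℝ := lam ρ 0 - lam ρ 1 - lam ρ 2 - lam ρ 3

/-- The concurrence of a two-qubit state. -/
def concurrence (ρ : Op) : ℝ := max (Lam ρ) 0

/-- The values `t C(σ)` for `t > 0` and entangled states `σ` with `C((ρ + t σ)/(1 + t)) > 0`. -/
def mixingCosts (ρ : Op) : Set ℝ :=
  {x | ∃ (t : ℝ) (σ : Op), 0 < t ∧ IsEntangled σ ∧ 0 < concurrence (mix t ρ σ) ∧
    x = t * concurrence σ}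

/-- The negative entanglement `N(ρ)`, minus the infimum of `mixingCosts ρ`. The infimum is taken
in the extended reals, so that it is the genuine one (and `+∞` for an empty set). -/
def negativeEntanglement (ρ : Op) : EReal :=
  -sInf ((fun x : ℝ => (x : EReal)) '' mixingCosts ρ)

end TwoQubit

end

/-!
The argument compares `ρ` with the quadratic form of the partial transpose, `ptForm W ρ`, on vectors
`W` of `ℂ² ⊗ ℂ²`, written as `2 × 2` matrices.

*Spin-flip normal form.* A positive operator `τ` can be written `V Vᴴ` with
`Vᵀ (σ_y ⊗ σ_y) V = diag(λ₁, …, λ₄)`. For invertible `τ` this is the Takagi factorization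
(`exists_takagi`) of a complex symmetric matrix; the general case, together with the convergence of
the `λ` numbers of `τ + 1 / (n + 1)` along a subsequence, follows by compactness
(`exists_lam_decomposition_limit`).

*Wootters' decomposition.* Multiplying the columns of `V` by phases and by a Hadamard matrix gives
`τ = ∑ ψ_k ψ_kᴴ` with `∑ C(ψ_k) = C(τ)` (`exists_pure_decomposition`). Hence entangled states have
positive concurrence, and the mixing cost `ε C(σ) ≤ ε` of an edge state is arbitrarily small.

*Converse.* Three facts about `ptForm W`:
* `ptForm W σ ≥ -|det W| C(σ)` for all positive `σ` (`neg_le_ptForm`), because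
  `Re tr (M conj M) ≥ -2 |det M|` for `2 × 2` matrices;
* for each invertible `W` some state `σ` has `ptForm W σ = -|det W|` (`exists_state_ptForm_eq`);
* if `Λ(τ) > 0`, then `ptForm W τ < 0` for some invertible `W` (`exists_witness`), because the
  columns of `V` are, up to local operations, the quaternion basis.

If `ρ` is not an edge state, then its mixtures with some weight `ε` are separable, and the second
fact gives `ptForm W ρ ≥ ε |det W|`. By the first fact, `ρ + t σ` then has nonnegative `ptForm W` as
long as `t C(σ) ≤ ε`, so that its concurrence is zero by the third. The mixing costs are thus
bounded below by `ε`, and `N(ρ) ≠ 0`.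
-/

namespace TwoQubit

open Matrix

/-! ### Takagi factorization of complex symmetric matrices -/

section Takagi

variable {n : Type*} [Fintype n]

/-- The antilinear map `x ↦ conj (T x)`, regarded as a real-linear operator. Its eigenvectors are
the columns of the unitary in the Takagi factorization of `T`. -/
noncomputable def antilinearMap (T : Matrix n n ℂ) :
    EuclideanSpace ℂ n →ₗ[ℝ] EuclideanSpace ℂ n where
  toFun x := WithLp.toLp 2 (star (T *ᵥ x.ofLp))
  map_add' x y := by
    ext i
    simp [mulVec_add]
  map_smul' c x := by
    ext i
    simp [mulVec_smul]

theorem antilinearMap_apply (T : Matrix n n ℂ) (x : EuclideanSpace ℂ n) :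
    (antilinearMap T x).ofLp = star (T *ᵥ x.ofLp) := rfl

theorem inner_antilinearMap (T : Matrix n n ℂ) (x y : EuclideanSpace ℂ n) :
    inner ℂ x (antilinearMap T y) = star (x.ofLp ⬝ᵥ T *ᵥ y.ofLp) := by
  rw [EuclideanSpace.inner_eq_star_dotProduct, antilinearMap_apply, ← star_dotProduct_star,
    dotProduct_comm]

theorem real_inner_euclideanSpace (x y : EuclideanSpace ℂ n) :
    inner ℝ x y = (inner ℂ x y).re := by
  simp [PiLp.inner_apply, Complex.inner]

theorem isSymmetric_antilinearMap {T : Matrix n n ℂ} (hT : Tᵀ = T) :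
    (antilinearMap T).IsSymmetric := by
  intro x y
  rw [real_inner_comm, real_inner_euclideanSpace, real_inner_euclideanSpace, inner_antilinearMap,
    inner_antilinearMap, dotProduct_mulVec, ← mulVec_transpose, hT, dotProduct_comm]

theorem antilinearMap_I_smul (T : Matrix n n ℂ) (x : EuclideanSpace ℂ n) :
    antilinearMap T (Complex.I • x) = -(Complex.I • antilinearMap T x) := by
  ext i
  simp [antilinearMap_apply, mulVec_smul]

/-- Real eigenvectors of a complex symmetric antilinear map, orthogonal over `ℝ`, are orthogonal
over `ℂ` when their eigenvalues are not opposite. -/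
theorem inner_eq_zero_of_antilinear_eigenvectors {T : Matrix n n ℂ} (hT : Tᵀ = T)
    {x y : EuclideanSpace ℂ n} {a b : ℝ} (hx : antilinearMap T x = a • x)
    (hy : antilinearMap T y = b • y) (hab : a + b ≠ 0) (hxy : inner ℝ x y = 0) :
    inner ℂ x y = 0 := by
  -- `I • x` is an eigenvector for `-a`, so that it is real-orthogonal to `y`
  have h := isSymmetric_antilinearMap hT (Complex.I • x) y
  rw [antilinearMap_I_smul, hx, hy, inner_neg_left, smul_comm, real_inner_smul_left,
    real_inner_smul_right] at h
  have h0 : inner ℝ (Complex.I • x) y = 0 := by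
    have : (a + b) * inner ℝ (Complex.I • x) y = 0 := by linarith
    exact (mul_eq_zero.mp this).resolve_left hab
  rw [real_inner_euclideanSpace] at h0 hxy
  rw [inner_smul_left] at h0
  apply Complex.ext
  · simpa using hxy
  · simpa using h0

theorem eq_zero_of_antilinearMap_eq_zero [DecidableEq n] {T : Matrix n n ℂ} (hT : IsUnit T)
    {x : EuclideanSpace ℂ n} (hx : antilinearMap T x = 0) : x = 0 := by
  have h1 : star (T *ᵥ x.ofLp) = 0 := by rw [← antilinearMap_apply, hx]; rfl
  have h2 : T *ᵥ x.ofLp = T *ᵥ 0 := by rw [mulVec_zero]; exact star_eq_zero.mp h1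
  have := mulVec_injective_of_isUnit hT h2
  ext i
  simp [this]

/-- **Takagi factorization** of an invertible complex symmetric matrix. -/
theorem exists_takagi [DecidableEq n] {T : Matrix n n ℂ} (hT : Tᵀ = T) (hu : IsUnit T) :
    ∃ (U : Matrix n n ℂ) (s : n → ℝ), U * Uᴴ = 1 ∧ (∀ i, 0 < s i) ∧
      Uᵀ * T * U = diagonal (fun i => (s i : ℂ)) := by
  set A := antilinearMap T with hA
  have hsym : A.IsSymmetric := isSymmetric_antilinearMap hT
  set m := Module.finrank ℝ (EuclideanSpace ℂ n) with hm
  have hm2 : m = 2 * Fintype.card n := by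
    rw [hm, finrank_real_of_complex, finrank_euclideanSpace]
  let b := hsym.eigenvectorBasis (n := m) rfl
  let μ := hsym.eigenvalues (n := m) rfl
  have hb : ∀ k, A (b k) = μ k • b k := fun k => hsym.apply_eigenvectorBasis rfl k
  have hμ : ∀ k, μ k ≠ 0 := by
    intro k hk
    have h1 := hb k
    rw [hk, zero_smul] at h1
    exact b.toBasis.ne_zero k (by simpa using eq_zero_of_antilinearMap_eq_zero hu h1)
  -- eigenvectors whose eigenvalues have equal signs form a complex orthonormal family
  have key : ∀ p : Fin m → Prop, (∀ k l, p k → p l → μ k + μ l ≠ 0) →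
      Orthonormal ℂ (fun k : {k // p k} => b k) := by
    intro p hp
    refine ⟨fun k => b.orthonormal.1 k, fun k l hkl => ?_⟩
    exact inner_eq_zero_of_antilinear_eigenvectors hT (hb k) (hb l) (hp k l k.2 l.2)
      (b.orthonormal.2 (fun h => hkl (Subtype.ext h)))
  have hpos := key (fun k => 0 < μ k) (fun k l hk hl => (add_pos hk hl).ne')
  have hneg := key (fun k => ¬ 0 < μ k) (fun k l hk hl => by
    have h1 := lt_of_le_of_ne (not_lt.mp hk) (hμ k)
    have h2 := lt_of_le_of_ne (not_lt.mp hl) (hμ l)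
    exact (add_neg h1 h2).ne)
  have c1 := hpos.linearIndependent.fintype_card_le_finrank
  have c2 := hneg.linearIndependent.fintype_card_le_finrank
  rw [finrank_euclideanSpace] at c1 c2
  have c3 := Fintype.card_subtype_compl (fun k => 0 < μ k)
  rw [Fintype.card_fin] at c3
  have c4 := Fintype.card_subtype_le (fun k => 0 < μ k)
  rw [Fintype.card_fin] at c4
  have hcard : Fintype.card n = Fintype.card {k // 0 < μ k} := by omega
  let e := Fintype.equivOfCardEq hcard
  let U : Matrix n n ℂ := Matrix.of fun i j => (b (e j)).ofLp i
  have horth : ∀ i j, inner ℂ (b (e i) : EuclideanSpace ℂ n) (b (e j)) = if i = j then 1 else 0 := by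
    intro i j
    have h := (orthonormal_iff_ite.mp hpos) (e i) (e j)
    simpa using h
  have hU : Uᴴ * U = 1 := by
    ext i j
    rw [one_apply, ← horth i j, EuclideanSpace.inner_eq_star_dotProduct, mul_apply]
    simp [U, dotProduct, mul_comm]
  refine ⟨U, fun i => μ (e i), mul_eq_one_comm.mp hU, fun i => (e i).2, ?_⟩
  ext i j
  have h1 := inner_antilinearMap T (b (e i)) (b (e j))
  rw [← hA, hb, inner_smul_right_eq_smul, horth] at h1
  have h2 : (Uᵀ * T * U) i j = (b (e i)).ofLp ⬝ᵥ T *ᵥ (b (e j)).ofLp := by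
    rw [Matrix.mul_assoc, mul_apply]
    rfl
  rw [h2, ← star_star ((b (e i)).ofLp ⬝ᵥ _), ← h1, diagonal_apply]
  by_cases hij : i = j <;> simp [hij]

end Takagi

/-! ### The decomposition that diagonalizes the spin-flip form -/

/-- The matrix `σ_y ⊗ σ_y` of the bilinear form `v ↦ vᵀ (σ_y ⊗ σ_y) v = -2 det v`. -/
noncomputable def spinFlip : Op := pauliY ⊗ₖ pauliY

theorem spinFlip_transpose : spinFlipᵀ = spinFlip := by
  ext ⟨i, j⟩ ⟨k, l⟩
  fin_cases i <;> fin_cases j <;> fin_cases k <;> fin_cases l <;> simp [spinFlip, pauliY]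

theorem spinFlip_map_conj : spinFlip.map (starRingEnd ℂ) = spinFlip := by
  ext ⟨i, j⟩ ⟨k, l⟩
  fin_cases i <;> fin_cases j <;> fin_cases k <;> fin_cases l <;> simp [spinFlip, pauliY]

theorem spinFlip_mul_self : spinFlip * spinFlip = 1 := by
  rw [spinFlip, ← mul_kronecker_mul]
  have : pauliY * pauliY = 1 := by
    ext i j
    fin_cases i <;> fin_cases j <;> simp [pauliY, mul_apply]
  rw [this, one_kronecker_one]

theorem lambdaList_eq_sort {τ : Op} {V : Matrix (Fin 2 × Fin 2) (Fin 2 × Fin 2) ℂ}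
    {s : Fin 2 × Fin 2 → ℝ} (hτ : V * Vᴴ = τ) (hs : ∀ i, 0 ≤ s i)
    (hV : Vᵀ * spinFlip * V = diagonal (fun i => (s i : ℂ))) :
    lambdaList τ = (Finset.univ.val.map s).sort (· ≥ ·) := by
  have hVc : Vᴴ * spinFlip * V.map (starRingEnd ℂ) = diagonal (fun i => (s i : ℂ)) := by
    have h := congrArg (fun M : Op => M.map (starRingEnd ℂ)) hV
    simp only [Matrix.map_mul, spinFlip_map_conj] at h
    rw [diagonal_map (map_zero _)] at h
    simp only [Complex.conj_ofReal] at h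
    exact h
  have hτc : τ.map (starRingEnd ℂ) = V.map (starRingEnd ℂ) * Vᵀ := by
    rw [← hτ, Matrix.map_mul]
    congr 1
    ext i j
    simp
  have hprod : spinFlipProduct τ =
      V * (Vᴴ * spinFlip * V.map (starRingEnd ℂ) * (Vᵀ * spinFlip)) := by
    change τ * spinFlip * τ.map (starRingEnd ℂ) * spinFlip = _
    rw [hτc, ← hτ]
    simp only [Matrix.mul_assoc]
  have hchar : (spinFlipProduct τ).charpoly =
      ∏ i, (Polynomial.X - Polynomial.C ((s i : ℂ) * s i)) := by
    rw [hprod, charpoly_mul_comm, Matrix.mul_assoc (_ * _ * _), hV, hVc, diagonal_mul_diagonal,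
      charpoly_diagonal]
  unfold lambdaList
  rw [hchar, Polynomial.roots_prod _ _ (Finset.prod_ne_zero_iff.mpr fun i _ =>
    Polynomial.X_sub_C_ne_zero _)]
  simp only [Polynomial.roots_X_sub_C, Multiset.bind_singleton, Multiset.map_map]
  congr 1
  refine Multiset.map_congr rfl fun i _ => ?_
  simp [Real.sqrt_mul_self (hs i)]

theorem transpose_mul_mul_submatrix {R l l' m : Type*} [CommRing R] [Fintype m]
    (B : Matrix m m R) (V : Matrix m l R) (e : l' → l) :
    (V.submatrix id e)ᵀ * B * V.submatrix id e = (Vᵀ * B * V).submatrix e e := by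
  ext i j
  simp [mul_apply]

/-- If `τ = V Vᴴ` and the columns of `V` are orthogonal for the spin-flip form, with nonnegative
decreasing values `s i`, then these are the `λ` numbers of `τ`. -/
theorem lam_eq_of_decomposition {τ : Op} {V : Matrix (Fin 2 × Fin 2) (Fin 4) ℂ} {s : Fin 4 → ℝ}
    (hτ : V * Vᴴ = τ) (hs : ∀ i, 0 ≤ s i) (hanti : Antitone s)
    (hV : Vᵀ * spinFlip * V = diagonal (fun i => (s i : ℂ))) : lam τ = s := by
  let e : Fin 2 × Fin 2 ≃ Fin 4 := finProdFinEquiv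
  have h := lambdaList_eq_sort (τ := τ) (V := V.submatrix id e) (s := s ∘ e)
    (by
      rw [conjTranspose_submatrix, submatrix_mul_equiv]
      simpa using hτ)
    (fun i => hs _)
    (by
      rw [transpose_mul_mul_submatrix, hV]
      ext i j
      simp [diagonal_apply, e.injective.eq_iff])
  have h2 : (Finset.univ.val.map (s ∘ e)) = (↑(List.ofFn s) : Multiset ℝ) := by
    rw [← Multiset.map_map, Multiset.map_univ_val_equiv, Fin.univ_val_map]
  have h3 : lambdaList τ = List.ofFn s := by
    rw [h, h2, Multiset.coe_sort]
    exact List.mergeSort_eq_self (· ≥ ·) (by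
      rw [List.pairwise_ofFn]
      exact fun i j hij => hanti hij.le)
  funext i
  simp only [lam, List.get_eq_getElem, h3, List.getElem_ofFn]
  rfl

theorem exists_mul_conjTranspose {ι : Type*} [Fintype ι] {τ : Matrix ι ι ℂ}
    (hτ : τ.PosSemidef) : ∃ V : Matrix ι ι ℂ, V * Vᴴ = τ := by
  classical
  open scoped MatrixOrder in
  obtain ⟨B, hB⟩ := CStarAlgebra.nonneg_iff_eq_star_mul_self.mp hτ.nonneg
  exact ⟨Bᴴ, by rw [conjTranspose_conjTranspose, hB, star_eq_conjTranspose]⟩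

theorem exists_lam_decomposition_of_posDef {τ : Op} (hτ : τ.PosDef) :
    ∃ V : Matrix (Fin 2 × Fin 2) (Fin 4) ℂ, V * Vᴴ = τ ∧ Antitone (lam τ) ∧ (∀ i, 0 < lam τ i) ∧
      Vᵀ * spinFlip * V = diagonal (fun i => (lam τ i : ℂ)) := by
  obtain ⟨B, hB⟩ := exists_mul_conjTranspose hτ.posSemidef
  have hBu : IsUnit B := by
    have h := hτ.isUnit
    rw [← hB, isUnit_iff_isUnit_det, det_mul] at h
    rw [isUnit_iff_isUnit_det]
    exact isUnit_of_mul_isUnit_left h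
  have hYu : IsUnit spinFlip := IsUnit.of_mul_eq_one _ spinFlip_mul_self
  have hTt : (Bᵀ * spinFlip * B)ᵀ = Bᵀ * spinFlip * B := by
    rw [transpose_mul, transpose_mul, transpose_transpose, spinFlip_transpose, Matrix.mul_assoc]
  obtain ⟨U, s, hU, hs, hUT⟩ := exists_takagi hTt
    (((isUnit_transpose _).mpr hBu |>.mul hYu).mul hBu)
  let e0 : Fin 4 ≃ Fin 2 × Fin 2 := (finProdFinEquiv (m := 2) (n := 2)).symm
  -- order the values decreasingly
  let e : Fin 4 ≃ Fin 2 × Fin 2 := (Tuple.sort (fun i => -s (e0 i))).trans e0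
  have hanti : Antitone (s ∘ e) := by
    intro i j hij
    have := Tuple.monotone_sort (fun i => -s (e0 i)) hij
    simpa [e] using this
  let V : Matrix (Fin 2 × Fin 2) (Fin 4) ℂ := (B * U).submatrix id e
  have h1 : V * Vᴴ = τ := by
    simp only [V]
    rw [conjTranspose_submatrix, submatrix_mul_equiv, submatrix_id_id, conjTranspose_mul,
      Matrix.mul_assoc, ← Matrix.mul_assoc U, hU, Matrix.one_mul, hB]
  have h2 : Vᵀ * spinFlip * V = diagonal (fun i => ((s ∘ e) i : ℂ)) := by
    have : Vᵀ * spinFlip * V = (Uᵀ * (Bᵀ * spinFlip * B) * U).submatrix e e := by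
      rw [transpose_mul_mul_submatrix]
      simp only [transpose_mul, Matrix.mul_assoc]
    rw [this, hUT]
    ext i j
    simp [diagonal_apply, e.injective.eq_iff]
  have h3 : lam τ = s ∘ e := lam_eq_of_decomposition h1 (fun i => (hs _).le) hanti h2
  exact ⟨V, h1, h3 ▸ hanti, fun i => h3 ▸ hs _, by rw [h2, h3]⟩

theorem re_mul_conjTranspose_apply {ι κ : Type*} [Fintype κ] (V : Matrix ι κ ℂ) (i : ι) :
    ((V * Vᴴ) i i).re = ∑ j, ‖V i j‖ ^ 2 := by
  simp [mul_apply, Complex.mul_conj, Complex.normSq_eq_norm_sq, -Complex.ofReal_pow]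

/-- The decompositions of the invertible operators `τ + 1 / (n + 1)` have a convergent subsequence,
whose limit is such a decomposition of `τ`; in particular the `λ` numbers converge. -/
theorem exists_lam_decomposition_limit {τ : Op} (hτ : τ.PosSemidef) :
    ∃ (V : Matrix (Fin 2 × Fin 2) (Fin 4) ℂ) (φ : ℕ → ℕ), StrictMono φ ∧
      V * Vᴴ = τ ∧ Antitone (lam τ) ∧ (∀ i, 0 ≤ lam τ i) ∧
      Vᵀ * spinFlip * V = diagonal (fun i => (lam τ i : ℂ)) ∧
      Filter.Tendsto (fun n => lam (τ + (1 / ((φ n : ℝ) + 1)) • (1 : Op)))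
        Filter.atTop (nhds (lam τ)) := by
  let σ : ℕ → Op := fun n => τ + (1 / ((n : ℝ) + 1)) • (1 : Op)
  have hσ : ∀ n, (σ n).PosDef := fun n =>
    PosDef.posSemidef_add hτ (PosDef.one.smul (by positivity))
  choose V hV hanti hpos hdiag using fun n => exists_lam_decomposition_of_posDef (hσ n)
  have hc : Filter.Tendsto σ Filter.atTop (nhds τ) := by
    have h := ((tendsto_one_div_add_atTop_nhds_zero_nat (𝕜 := ℝ)).smul_const (1 : Op)).const_add τ
    simpa only [zero_smul, add_zero] using h
  let K : Set (Matrix (Fin 2 × Fin 2) (Fin 4) ℂ) :=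
    Set.univ.pi fun i => Set.univ.pi fun _ => Metric.closedBall 0 (1 + ‖τ i i‖)
  have hK : IsCompact K :=
    isCompact_univ_pi fun i => isCompact_univ_pi fun _ => isCompact_closedBall _ _
  have hVK : ∀ n, V n ∈ K := by
    intro n i _ j _
    rw [mem_closedBall_zero_iff]
    have h1 := re_mul_conjTranspose_apply (V n) i
    have h2 : ‖V n i j‖ ^ 2 ≤ ∑ j, ‖V n i j‖ ^ 2 :=
      Finset.single_le_sum (f := fun j => ‖V n i j‖ ^ 2) (fun _ _ => by positivity)
        (Finset.mem_univ j)
    rw [← h1, hV n] at h2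
    have h3 : ((σ n) i i).re = (τ i i).re + 1 / ((n : ℝ) + 1) := by
      change (τ i i + ((1 / ((n : ℝ) + 1)) • (1 : Op)) i i).re = _
      rw [Matrix.smul_apply, one_apply_eq, Complex.add_re, Complex.smul_re, Complex.one_re,
        smul_eq_mul, mul_one]
    have h4 : 1 / ((n : ℝ) + 1) ≤ 1 := by
      rw [div_le_one (by positivity)]
      linarith [Nat.cast_nonneg (α := ℝ) n]
    have h5 := Complex.re_le_norm (τ i i)
    nlinarith [norm_nonneg (τ i i), norm_nonneg (V n i j)]
  have : FirstCountableTopology (Matrix (Fin 2 × Fin 2) (Fin 4) ℂ) :=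
    inferInstanceAs (FirstCountableTopology (Fin 2 × Fin 2 → Fin 4 → ℂ))
  obtain ⟨W, -, φ, hφ, hW⟩ := hK.tendsto_subseq hVK
  have hWτ : W * Wᴴ = τ := by
    have c : Continuous fun M : Matrix (Fin 2 × Fin 2) (Fin 4) ℂ => M * Mᴴ := by fun_prop
    refine tendsto_nhds_unique ((c.tendsto W).comp hW) ?_
    have : (fun M : Matrix (Fin 2 × Fin 2) (Fin 4) ℂ => M * Mᴴ) ∘ V ∘ φ = σ ∘ φ := by
      funext n
      exact hV _
    rw [this]
    exact hc.comp hφ.tendsto_atTop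
  have cD : Continuous fun M : Matrix (Fin 2 × Fin 2) (Fin 4) ℂ => Mᵀ * spinFlip * M := by fun_prop
  have hD := (cD.tendsto W).comp hW
  have hD2 : (fun M : Matrix (Fin 2 × Fin 2) (Fin 4) ℂ => Mᵀ * spinFlip * M) ∘ V ∘ φ =
      fun n => diagonal (fun i => (lam (σ (φ n)) i : ℂ)) := by
    funext n
    exact hdiag _
  rw [hD2] at hD
  have hentry : ∀ i j, Filter.Tendsto (fun n => diagonal (fun i => (lam (σ (φ n)) i : ℂ)) i j)
      Filter.atTop (nhds ((Wᵀ * spinFlip * W) i j)) := fun i j =>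
    ((continuous_id.matrix_elem i j).tendsto (Wᵀ * spinFlip * W)).comp hD
  let s : Fin 4 → ℝ := fun i => ((Wᵀ * spinFlip * W) i i).re
  have hs : ∀ i, Filter.Tendsto (fun n => lam (σ (φ n)) i) Filter.atTop (nhds (s i)) := by
    intro i
    have h := (Complex.continuous_re.tendsto _).comp (hentry i i)
    simpa [Function.comp_def] using h
  have hs0 : ∀ i, 0 ≤ s i := fun i => ge_of_tendsto' (hs i) fun n => (hpos _ i).le
  have hsa : Antitone s := fun i j hij => le_of_tendsto_of_tendsto' (hs j) (hs i) fun n =>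
    hanti _ hij
  have hWD : Wᵀ * spinFlip * W = diagonal (fun i => (s i : ℂ)) := by
    ext i j
    refine tendsto_nhds_unique (hentry i j) ?_
    by_cases hij : i = j
    · subst hij
      simpa [Function.comp_def] using (Complex.continuous_ofReal.tendsto _).comp (hs i)
    · simp [hij]
  have hlam : lam τ = s := lam_eq_of_decomposition hWτ hs0 hsa hWD
  rw [hlam]
  exact ⟨W, φ, hφ, hWτ, hsa, hs0, hWD, tendsto_pi_nhds.mpr hs⟩

/-! ### Decompositions into pure states of small concurrence -/

/-- The modulus of `a + b z`, for `z` on the unit circle, takes every value between `|a - b|` and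
`a + b`. -/
theorem exists_norm_add_mul_eq {a b r : ℝ} (hab : |a - b| ≤ r) (hr : r ≤ a + b) :
    ∃ z : ℂ, ‖z‖ = 1 ∧ ‖(a : ℂ) + b * z‖ = r := by
  have hc : Continuous fun θ : ℝ => ‖(a : ℂ) + b * Complex.exp (θ * Complex.I)‖ := by fun_prop
  have h0 : ‖(a : ℂ) + b * Complex.exp ((0 : ℝ) * Complex.I)‖ = a + b := by
    have : 0 ≤ a + b := (abs_nonneg _).trans (hab.trans hr)
    simpa [← Complex.ofReal_add] using this
  have h1 : ‖(a : ℂ) + b * Complex.exp (Real.pi * Complex.I)‖ = |a - b| := by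
    rw [Complex.exp_pi_mul_I, mul_neg_one, ← sub_eq_add_neg, ← Complex.ofReal_sub,
      Complex.norm_real, Real.norm_eq_abs]
  obtain ⟨θ, -, hθ⟩ := intermediate_value_Icc' Real.pi_pos.le hc.continuousOn
    (show r ∈ Set.Icc _ _ by rw [h0, h1]; exact ⟨hab, hr⟩)
  exact ⟨_, Complex.norm_exp_ofReal_mul_I θ, hθ⟩

/-- Segments of lengths `s 0 ≥ s 1 ≥ s 2 ≥ s 3` can be arranged in the plane so that their ends are
at distance `max (s 0 - s 1 - s 2 - s 3) 0`. -/
theorem exists_phases {s : Fin 4 → ℝ} (hs : Antitone s) (h0 : ∀ i, 0 ≤ s i) :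
    ∃ z : Fin 4 → ℂ, (∀ i, ‖z i‖ = 1) ∧
      ‖∑ i, (s i : ℂ) * z i‖ = max (s 0 - s 1 - s 2 - s 3) 0 := by
  have h01 : s 1 ≤ s 0 := hs (by decide)
  have h12 : s 2 ≤ s 1 := hs (by decide)
  have h23 : s 3 ≤ s 2 := hs (by decide)
  have h3 := h0 3
  rcases le_total 0 (s 0 - s 1 - s 2 - s 3) with h | h
  · refine ⟨![1, -1, -1, -1], fun i => by fin_cases i <;> simp, ?_⟩
    rw [max_eq_left h]
    have : ∑ i, (s i : ℂ) * (![1, -1, -1, -1] : Fin 4 → ℂ) i =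
        ((s 0 - s 1 - s 2 - s 3 : ℝ) : ℂ) := by
      simp [Fin.sum_univ_four]
      ring
    rw [this, Complex.norm_real, Real.norm_eq_abs, abs_of_nonneg h]
  · -- two triangles over a common side of length `r` close the quadrilateral
    obtain ⟨x, hx, hx'⟩ := exists_norm_add_mul_eq (a := s 0) (b := s 1)
      (r := max (s 0 - s 1) (s 2 - s 3))
      (by rw [abs_of_nonneg (by linarith)]; exact le_max_left _ _)
      (max_le (by linarith) (by linarith))
    obtain ⟨y, hy, hy'⟩ := exists_norm_add_mul_eq (a := s 2) (b := s 3)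
      (r := max (s 0 - s 1) (s 2 - s 3))
      (by rw [abs_of_nonneg (by linarith)]; exact le_max_right _ _)
      (max_le (by linarith) (by linarith))
    obtain ⟨c, hc, hc'⟩ : ∃ c : ℂ, ‖c‖ = 1 ∧
        (s 0 : ℂ) + s 1 * x + c * (s 2 + s 3 * y) = 0 := by
      by_cases hz : (s 2 : ℂ) + s 3 * y = 0
      · refine ⟨1, by simp, ?_⟩
        rw [hz, norm_zero, ← hx'] at hy'
        rw [hz, norm_eq_zero.mp hy'.symm]
        simp
      · refine ⟨-((s 0 : ℂ) + s 1 * x) / (s 2 + s 3 * y), ?_, by field_simp; ring⟩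
        rw [norm_div, norm_neg, hx', hy', div_self]
        rw [← hy']
        exact norm_ne_zero_iff.mpr hz
    refine ⟨![1, x, c, c * y], fun i => by fin_cases i <;> simp [hx, hy, hc], ?_⟩
    rw [max_eq_right h, norm_eq_zero, ← hc']
    simp [Fin.sum_univ_four]
    ring

/-- A symmetric orthogonal matrix all of whose entries are `± 1 / 2`: conjugating with it makes the
diagonal of a diagonal matrix constant. -/
noncomputable def hadamardFour : Matrix (Fin 4) (Fin 4) ℂ :=
  (1 / 2 : ℂ) • !![1, 1, 1, 1; 1, 1, -1, -1; 1, -1, 1, -1; 1, -1, -1, 1]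

theorem hadamardFour_mul_conjTranspose : hadamardFour * hadamardFourᴴ = 1 := by
  ext i j
  fin_cases i <;> fin_cases j <;>
    simp [hadamardFour, mul_apply, Fin.sum_univ_four, Complex.conj_ofNat] <;> norm_num

theorem hadamardFour_diagonal (d : Fin 4 → ℂ) (k : Fin 4) :
    (hadamardFourᵀ * diagonal d * hadamardFour) k k = (∑ i, d i) / 4 := by
  fin_cases k <;>
    simp [hadamardFour, mul_apply, diagonal_apply, Fin.sum_univ_four] <;> ring

/-- The determinant of a vector of `ℂ² ⊗ ℂ²` regarded as a `2 × 2` matrix. It vanishes exactly on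
product vectors, and the pure state `ψ` has concurrence `2 |det ψ|`. -/
def vecDet (ψ : Fin 2 × Fin 2 → ℂ) : ℂ := ψ (0, 0) * ψ (1, 1) - ψ (0, 1) * ψ (1, 0)

/-- The unnormalized pure state `ψ ψᴴ`. -/
def pureOp {ι : Type*} (ψ : ι → ℂ) : Matrix ι ι ℂ := vecMulVec ψ (star ψ)

theorem mul_conjTranspose_eq_sum {ι κ : Type*} [Fintype κ] (P : Matrix ι κ ℂ) :
    P * Pᴴ = ∑ k, pureOp (P.col k) := by
  ext i j
  simp [mul_apply, Matrix.sum_apply, pureOp, vecMulVec_apply]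

theorem spinFlip_form_apply {κ : Type*} (V : Matrix (Fin 2 × Fin 2) κ ℂ) (k l : κ) :
    (Vᵀ * spinFlip * V) k l = V (0, 1) k * V (1, 0) l + V (1, 0) k * V (0, 1) l -
      V (0, 0) k * V (1, 1) l - V (1, 1) k * V (0, 0) l := by
  simp [mul_apply, Fintype.sum_prod_type, spinFlip, pauliY]
  ring

theorem spinFlip_form_self {κ : Type*} (V : Matrix (Fin 2 × Fin 2) κ ℂ) (k : κ) :
    (Vᵀ * spinFlip * V) k k = -2 * vecDet (V.col k) := by
  rw [spinFlip_form_apply]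
  simp only [vecDet, Matrix.col_apply]
  ring

/-- Every positive operator is a sum of four pure ones whose concurrences add up to its
concurrence (Wootters). -/
theorem exists_pure_decomposition {τ : Op} (hτ : τ.PosSemidef) :
    ∃ ψ : Fin 4 → Fin 2 × Fin 2 → ℂ, τ = ∑ k, pureOp (ψ k) ∧
      ∑ k, 2 * ‖vecDet (ψ k)‖ = concurrence τ := by
  obtain ⟨V, -, -, hV, hanti, h0, hd, -⟩ := exists_lam_decomposition_limit hτ
  obtain ⟨z, hz, hsum⟩ := exists_phases hanti h0
  choose w hw using fun i => IsAlgClosed.exists_pow_nat_eq (z i) (n := 2) (by norm_num)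
  have hw1 : ∀ i, w i * star (w i) = 1 := by
    intro i
    have h : ‖w i‖ ^ 2 = 1 := by rw [← norm_pow, hw, hz]
    rw [Complex.star_def, Complex.mul_conj, Complex.normSq_eq_norm_sq, h, Complex.ofReal_one]
  have hD : diagonal w * (diagonal w)ᴴ = 1 := by
    rw [diagonal_conjTranspose, diagonal_mul_diagonal, ← diagonal_one]
    exact congrArg diagonal (funext hw1)
  let P := V * (diagonal w * hadamardFour)
  have hP : P * Pᴴ = τ := by
    have h2 : (diagonal w * hadamardFour) * (diagonal w * hadamardFour)ᴴ = 1 := by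
      rw [conjTranspose_mul, Matrix.mul_assoc, ← Matrix.mul_assoc hadamardFour,
        hadamardFour_mul_conjTranspose, Matrix.one_mul, hD]
    rw [conjTranspose_mul, Matrix.mul_assoc, ← Matrix.mul_assoc (diagonal w * _), h2,
      Matrix.one_mul, hV]
  have hPd : ∀ k, (Pᵀ * spinFlip * P) k k = (∑ i, (lam τ i : ℂ) * z i) / 4 := by
    intro k
    have h1 : Pᵀ * spinFlip * P =
        hadamardFourᵀ * (diagonal w * (Vᵀ * spinFlip * V) * diagonal w) * hadamardFour := by
      simp only [P, transpose_mul, diagonal_transpose, Matrix.mul_assoc]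
    rw [h1, hd, diagonal_mul_diagonal, diagonal_mul_diagonal, hadamardFour_diagonal]
    congr 1
    refine Finset.sum_congr rfl fun i _ => ?_
    rw [← hw]
    ring
  refine ⟨P.col, by rw [← mul_conjTranspose_eq_sum, hP], ?_⟩
  have h2 : ∀ k, 2 * ‖vecDet (P.col k)‖ = concurrence τ / 4 := by
    intro k
    have h3 := congrArg norm (hPd k)
    rw [spinFlip_form_self, norm_div, hsum, norm_mul, norm_neg] at h3
    simpa [concurrence, Lam] using h3
  simp only [h2, Finset.sum_const, Finset.card_univ, Fintype.card_fin, nsmul_eq_mul]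
  push_cast
  ring

theorem trace_pureOp {ι : Type*} [Fintype ι] (ψ : ι → ℂ) :
    (pureOp ψ).trace = ((∑ i, ‖ψ i‖ ^ 2 : ℝ) : ℂ) := by
  simp [pureOp, trace, vecMulVec_apply, Complex.mul_conj, Complex.normSq_eq_norm_sq]

theorem posSemidef_pureOp {ι : Type*} [Finite ι] (ψ : ι → ℂ) : (pureOp ψ).PosSemidef :=
  posSemidef_vecMulVec_self_star ψ

theorem concurrence_le_one {τ : Op} (hτ : IsState τ) : concurrence τ ≤ 1 := by
  obtain ⟨V, -, -, hV, -, h0, hd, -⟩ := exists_lam_decomposition_limit hτ.1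
  have h1 := spinFlip_form_self V 0
  rw [hd, diagonal_apply_eq] at h1
  have h2 : lam τ 0 = 2 * ‖vecDet (V.col 0)‖ := by
    have h := congrArg norm h1
    rw [Complex.norm_real, Real.norm_eq_abs, abs_of_nonneg (h0 0)] at h
    simpa using h
  have h3 : ‖vecDet (V.col 0)‖ ≤ ‖V (0, 0) 0‖ * ‖V (1, 1) 0‖ + ‖V (0, 1) 0‖ * ‖V (1, 0) 0‖ := by
    rw [← norm_mul, ← norm_mul]
    exact norm_sub_le _ _
  have h4 : ∑ i, ‖V i 0‖ ^ 2 ≤ 1 := by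
    have h5 := congrArg trace hV
    rw [hτ.2, mul_conjTranspose_eq_sum, trace_sum] at h5
    simp only [trace_pureOp] at h5
    have h6 : ∑ k, ∑ i, ‖V.col k i‖ ^ 2 = 1 := by exact_mod_cast h5
    rw [← h6]
    exact Finset.single_le_sum (f := fun k => ∑ i, ‖V.col k i‖ ^ 2)
      (fun _ _ => by positivity) (Finset.mem_univ 0)
  rw [Fintype.sum_prod_type] at h4
  simp only [Fin.sum_univ_two] at h4
  refine max_le ?_ zero_le_one
  have := h0 1
  have := h0 2
  have := h0 3
  simp only [Lam]
  nlinarith [sq_nonneg (‖V (0, 0) 0‖ - ‖V (1, 1) 0‖), sq_nonneg (‖V (0, 1) 0‖ - ‖V (1, 0) 0‖)]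

/-! ### Separability when the concurrence vanishes -/

theorem isState_single : IsState (pureOp (Pi.single 0 1 : Fin 2 → ℂ)) :=
  ⟨posSemidef_pureOp _, by simp [trace_pureOp, Fin.sum_univ_two]⟩

theorem exists_state_smul_eq_pureOp (a : Fin 2 → ℂ) :
    ∃ (r : ℝ) (A : Matrix (Fin 2) (Fin 2) ℂ), 0 ≤ r ∧ IsState A ∧ pureOp a = r • A := by
  rcases eq_or_ne a 0 with rfl | ha
  · exact ⟨0, _, le_rfl, isState_single, by simp [pureOp]⟩
  have hpos : 0 < ∑ i, ‖a i‖ ^ 2 := by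
    obtain ⟨i, hi⟩ := Function.ne_iff.mp ha
    exact Finset.sum_pos' (fun _ _ => by positivity)
      ⟨i, Finset.mem_univ i, pow_pos (norm_pos_iff.mpr hi) 2⟩
  refine ⟨_, (∑ i, ‖a i‖ ^ 2)⁻¹ • pureOp a, hpos.le,
    ⟨(posSemidef_pureOp a).smul (inv_nonneg.mpr hpos.le), ?_⟩, ?_⟩
  · rw [trace_smul, trace_pureOp, Complex.real_smul, ← Complex.ofReal_mul,
      inv_mul_cancel₀ hpos.ne', Complex.ofReal_one]
  · rw [smul_smul, mul_inv_cancel₀ hpos.ne', one_smul]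

theorem exists_eq_mul_of_vecDet_eq_zero {ψ : Fin 2 × Fin 2 → ℂ} (h : vecDet ψ = 0) :
    ∃ a b : Fin 2 → ℂ, ψ = fun p => a p.1 * b p.2 := by
  rcases eq_or_ne ψ 0 with rfl | hψ
  · exact ⟨0, 0, by ext; simp⟩
  obtain ⟨⟨i, j⟩, hij⟩ := Function.ne_iff.mp hψ
  refine ⟨fun k => ψ (k, j), fun l => ψ (i, l) / ψ (i, j), ?_⟩
  ext ⟨k, l⟩
  simp only [vecDet, Pi.zero_apply] at h hij ⊢
  fin_cases i <;> fin_cases j <;> fin_cases k <;> fin_cases l <;> simp at hij ⊢ <;>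
    field_simp <;> first | linear_combination h | linear_combination -h

theorem exists_states_of_vecDet_eq_zero {ψ : Fin 2 × Fin 2 → ℂ} (h : vecDet ψ = 0) :
    ∃ (p : ℝ) (A B : Matrix (Fin 2) (Fin 2) ℂ), 0 ≤ p ∧ IsState A ∧ IsState B ∧
      pureOp ψ = p • (A ⊗ₖ B) := by
  obtain ⟨a, b, rfl⟩ := exists_eq_mul_of_vecDet_eq_zero h
  obtain ⟨r, A, hr, hA, hA'⟩ := exists_state_smul_eq_pureOp a
  obtain ⟨t, B, ht, hB, hB'⟩ := exists_state_smul_eq_pureOp b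
  refine ⟨r * t, A, B, mul_nonneg hr ht, hA, hB, ?_⟩
  have h1 : pureOp (fun p : Fin 2 × Fin 2 => a p.1 * b p.2) = pureOp a ⊗ₖ pureOp b := by
    ext ⟨i, j⟩ ⟨k, l⟩
    simp [pureOp, vecMulVec_apply]
    ring
  rw [h1, hA', hB', smul_kronecker, kronecker_smul, smul_smul]

/-- A state of zero concurrence is separable (Wootters). -/
theorem isSeparable_of_concurrence_eq_zero {τ : Op} (hτ : IsState τ) (h : concurrence τ = 0) :
    IsSeparable τ := by
  obtain ⟨ψ, hψ, hC⟩ := exists_pure_decomposition hτ.1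
  rw [h, Finset.sum_eq_zero_iff_of_nonneg fun _ _ => by positivity] at hC
  have hdet : ∀ k, vecDet (ψ k) = 0 := fun k => by simpa using hC k (Finset.mem_univ k)
  choose p A B hp hA hB hAB using fun k => exists_states_of_vecDet_eq_zero (hdet k)
  refine ⟨4, p, A, B, hp, ?_, hA, hB, by rw [hψ]; exact Finset.sum_congr rfl fun k _ => hAB k⟩
  have htr := hτ.2
  rw [hψ, trace_sum] at htr
  simp only [hAB, trace_smul, trace_kronecker, (hA _).2, (hB _).2, mul_one] at htr
  have : ((∑ k, p k : ℝ) : ℂ) = 1 := by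
    rw [← htr]
    simp
  exact_mod_cast this

/-! ### The quadratic form of the partial transpose -/

/-- The quadratic form `W ↦ ⟨W, τ^Γ W⟩` of the partial transpose `τ^Γ` of `τ`, the vector `W` of
`ℂ² ⊗ ℂ²` being written as a `2 × 2` matrix; as a function of `τ` it is real-linear. -/
noncomputable def ptForm (W : Matrix (Fin 2) (Fin 2) ℂ) : Op →ₗ[ℝ] ℝ where
  toFun τ := (∑ i, ∑ j, ∑ k, ∑ l, star (W i j) * τ (i, l) (k, j) * W k l).re
  map_add' τ τ' := by
    simp only [Matrix.add_apply, mul_add, add_mul, Finset.sum_add_distrib, Complex.add_re]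
  map_smul' c τ := by
    simp only [Matrix.smul_apply, mul_smul_comm, smul_mul_assoc, ← Finset.smul_sum,
      Complex.smul_re, RingHom.id_apply]

theorem ptForm_apply (W : Matrix (Fin 2) (Fin 2) ℂ) (τ : Op) :
    ptForm W τ = (∑ i, ∑ j, ∑ k, ∑ l, star (W i j) * τ (i, l) (k, j) * W k l).re := rfl

/-- The partial transpose of a product `A ⊗ B` is `A ⊗ Bᵀ`. -/
theorem ptForm_kronecker_nonneg (W : Matrix (Fin 2) (Fin 2) ℂ) {A B : Matrix (Fin 2) (Fin 2) ℂ}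
    (hA : A.PosSemidef) (hB : B.PosSemidef) : 0 ≤ ptForm W (A ⊗ₖ B) := by
  have h := (hA.kronecker hB.transpose).re_dotProduct_nonneg (fun p => W p.1 p.2)
  have h2 : ptForm W (A ⊗ₖ B) = RCLike.re (star (fun p : Fin 2 × Fin 2 => W p.1 p.2) ⬝ᵥ
      (kroneckerMap (fun x1 x2 => x1 * x2) A Bᵀ) *ᵥ (fun p => W p.1 p.2)) := by
    rw [ptForm_apply]
    simp only [dotProduct, mulVec, Fintype.sum_prod_type, Finset.mul_sum, kroneckerMap_apply,
      Pi.star_apply, transpose_apply, RCLike.re_to_complex, mul_assoc]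
  rwa [h2]

theorem ptForm_one_nonneg (W : Matrix (Fin 2) (Fin 2) ℂ) : 0 ≤ ptForm W 1 := by
  rw [← one_kronecker_one]
  exact ptForm_kronecker_nonneg W PosSemidef.one PosSemidef.one

theorem ptForm_nonneg_of_isSeparable (W : Matrix (Fin 2) (Fin 2) ℂ) {τ : Op}
    (hτ : IsSeparable τ) : 0 ≤ ptForm W τ := by
  obtain ⟨n, p, A, B, hp, -, hA, hB, rfl⟩ := hτ
  rw [map_sum]
  refine Finset.sum_nonneg fun i _ => ?_
  rw [map_smul, smul_eq_mul]
  exact mul_nonneg (hp i) (ptForm_kronecker_nonneg W (hA i).1 (hB i).1)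

/-- A vector of `ℂ² ⊗ ℂ²` written as a `2 × 2` matrix. -/
def vecMat (ψ : Fin 2 × Fin 2 → ℂ) : Matrix (Fin 2) (Fin 2) ℂ := Matrix.of fun i j => ψ (i, j)

theorem det_vecMat (ψ : Fin 2 × Fin 2 → ℂ) : (vecMat ψ).det = vecDet ψ := by
  simp [det_fin_two, vecMat, vecDet]

theorem ptForm_pureOp (W : Matrix (Fin 2) (Fin 2) ℂ) (ψ : Fin 2 × Fin 2 → ℂ) :
    ptForm W (pureOp ψ) =
      ((Wᴴ * vecMat ψ) * (Wᴴ * vecMat ψ).map (starRingEnd ℂ)).trace.re := by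
  rw [ptForm_apply]
  congr 1
  simp [trace, mul_apply, vecMat, pureOp, vecMulVec_apply, Fin.sum_univ_two]
  ring

theorem neg_two_mul_norm_det_le_re_trace (M : Matrix (Fin 2) (Fin 2) ℂ) :
    -2 * ‖M.det‖ ≤ (M * M.map (starRingEnd ℂ)).trace.re := by
  have h1 : (M * M.map (starRingEnd ℂ)).trace.re =
      ‖M 0 0‖ ^ 2 + ‖M 1 1‖ ^ 2 + 2 * (M 0 1 * star (M 1 0)).re := by
    simp [trace, mul_apply, Fin.sum_univ_two, ← Complex.normSq_eq_norm_sq, Complex.normSq_apply]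
    ring
  have h2 : -(‖M 0 1‖ * ‖M 1 0‖) ≤ (M 0 1 * star (M 1 0)).re := by
    have h := (abs_le.mp (Complex.abs_re_le_norm (M 0 1 * star (M 1 0)))).1
    rwa [norm_mul, norm_star] at h
  have h3 : ‖M 0 1‖ * ‖M 1 0‖ ≤ ‖M 0 0‖ * ‖M 1 1‖ + ‖M.det‖ := by
    have : M 0 1 * M 1 0 = M 0 0 * M 1 1 - M.det := by
      rw [det_fin_two]
      ring
    rw [← norm_mul, this, ← norm_mul]
    exact norm_sub_le _ _
  rw [h1]
  nlinarith [sq_nonneg (‖M 0 0‖ - ‖M 1 1‖)]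

/-- The negativity of a pure state is controlled by its concurrence, uniformly under invertible
local operations. -/
theorem neg_le_ptForm_pureOp (W : Matrix (Fin 2) (Fin 2) ℂ) (ψ : Fin 2 × Fin 2 → ℂ) :
    -(‖W.det‖ * (2 * ‖vecDet ψ‖)) ≤ ptForm W (pureOp ψ) := by
  have h := neg_two_mul_norm_det_le_re_trace (Wᴴ * vecMat ψ)
  rw [det_mul, det_conjTranspose, det_vecMat, norm_mul, norm_star] at h
  rw [ptForm_pureOp]
  linarith

theorem neg_le_ptForm (W : Matrix (Fin 2) (Fin 2) ℂ) {τ : Op} (hτ : τ.PosSemidef) :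
    -(‖W.det‖ * concurrence τ) ≤ ptForm W τ := by
  obtain ⟨ψ, hψ, hC⟩ := exists_pure_decomposition hτ
  rw [← hC, Finset.mul_sum, ← Finset.sum_neg_distrib]
  conv_rhs => rw [hψ, map_sum]
  exact Finset.sum_le_sum fun k _ => neg_le_ptForm_pureOp W (ψ k)

/-- The partial transpose of the pure operator of the vector `W` has `-|det W|` as its smallest
eigenvalue when `W` is invertible. It is attained at the maximally entangled vector
`(W + ω adj(W)ᴴ) e`, up to normalization, where `ω` is the phase of
`det W`, `W + ω adj(W)ᴴ` is a multiple of the unitary part of `W`, and `e` is the skew matrix. -/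
theorem exists_state_ptForm_eq {W : Matrix (Fin 2) (Fin 2) ℂ} (hW : W.det ≠ 0) :
    ∃ σ : Op, IsState σ ∧ ptForm W σ = -‖W.det‖ := by
  set D : ℝ := ‖W.det‖ with hD
  have hDpos : 0 < D := norm_pos_iff.mpr hW
  have hDc : (D : ℂ) ≠ 0 := by exact_mod_cast hDpos.ne'
  have hdd : W.det * star W.det = (D : ℂ) * D := by
    rw [Complex.star_def, Complex.mul_conj, Complex.normSq_eq_norm_sq]
    push_cast
    ring
  set ω : ℂ := W.det / D with hω
  have hωs : star ω = star W.det / D := by simp [hω]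
  have h1 : ω * star W.det = D := by
    rw [hω, div_mul_eq_mul_div, hdd]
    field_simp
  have h2 : star ω * W.det = D := by
    rw [hωs, div_mul_eq_mul_div, mul_comm, hdd]
    field_simp
  have h3 : ω * star ω = 1 := by
    rw [mul_comm, ← div_self hDc, ← h2, mul_div_assoc, h2, ← hω]
  rw [det_fin_two] at h1 h2
  have hdet : W.det = W 0 0 * W 1 1 - W 0 1 * W 1 0 := det_fin_two W
  rw [hdet] at hdd
  simp only [star_sub, star_mul', Complex.star_def] at h1 h2 h3 hdd
  clear_value ω D
  generalize ha : W 0 0 = a at *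
  generalize hb : W 0 1 = b at *
  generalize hc : W 1 0 = c at *
  generalize hd : W 1 1 = d at *
  let ψ : Fin 2 × Fin 2 → ℂ := fun p =>
    !![-(b - ω * star c), a + ω * star d; -(d + ω * star a), c - ω * star b] p.1 p.2
  let n : ℝ := 2 * (‖a‖ ^ 2 + ‖b‖ ^ 2 + ‖c‖ ^ 2 + ‖d‖ ^ 2 + 2 * D)
  have hn : 0 < n := by positivity
  have hnc : (n : ℂ) = 2 * (a * (starRingEnd ℂ) a + b * (starRingEnd ℂ) b +
      c * (starRingEnd ℂ) c + d * (starRingEnd ℂ) d + 2 * D) := by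
    simp only [n, Complex.mul_conj, Complex.normSq_eq_norm_sq]
    push_cast
    ring
  have htr : (pureOp ψ).trace = n := by
    rw [hnc]
    simp [pureOp, trace, vecMulVec_apply, ψ, Fintype.sum_prod_type]
    linear_combination (a * (starRingEnd ℂ) a + b * (starRingEnd ℂ) b +
      c * (starRingEnd ℂ) c + d * (starRingEnd ℂ) d) * h3 + 2 * h1 + 2 * h2
  have hpt : ptForm W (pureOp ψ) = -(D * n) := by
    rw [ptForm_pureOp]
    have h00 : (Wᴴ * vecMat ψ) 0 0 = -((starRingEnd ℂ) a * b + (starRingEnd ℂ) c * d) := by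
      simp [mul_apply, vecMat, ψ, Fin.sum_univ_two, ha, hc]
      ring
    have h11 : (Wᴴ * vecMat ψ) 1 1 = (starRingEnd ℂ) b * a + (starRingEnd ℂ) d * c := by
      simp [mul_apply, vecMat, ψ, Fin.sum_univ_two, hb, hd]
      ring
    have h01 : (Wᴴ * vecMat ψ) 0 1 = (starRingEnd ℂ) a * a + (starRingEnd ℂ) c * c + D := by
      simp [mul_apply, vecMat, ψ, Fin.sum_univ_two, ha, hc]
      linear_combination h1
    have h10 : (Wᴴ * vecMat ψ) 1 0 = -((starRingEnd ℂ) b * b + (starRingEnd ℂ) d * d + D) := by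
      simp [mul_apply, vecMat, ψ, Fin.sum_univ_two, hb, hd]
      linear_combination -h1
    have : ((Wᴴ * vecMat ψ) * (Wᴴ * vecMat ψ).map (starRingEnd ℂ)).trace =
        ((-(D * n) : ℝ) : ℂ) := by
      push_cast
      rw [hnc, trace_fin_two, mul_apply, mul_apply]
      simp only [Fin.sum_univ_two, map_apply, h00, h11, h01, h10]
      simp
      linear_combination -2 * hdd
    rw [this, Complex.ofReal_re]
  refine ⟨n⁻¹ • pureOp ψ, ⟨(posSemidef_pureOp ψ).smul (inv_nonneg.mpr hn.le), ?_⟩, ?_⟩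
  · rw [trace_smul, htr, Complex.real_smul, ← Complex.ofReal_mul, inv_mul_cancel₀ hn.ne',
      Complex.ofReal_one]
  · rw [map_smul, hpt, smul_eq_mul]
    field_simp

/-! ### A witness for positive concurrence -/

/-- The skew matrix `e`. A matrix `S` satisfies `e S = conj(S) e` if and only if it is a real linear
combination of the unit quaternions in `SU(2)`. -/
def skew : Matrix (Fin 2) (Fin 2) ℂ := !![0, 1; -1, 0]

theorem skew_mul_map_conj : skew * skew.map (starRingEnd ℂ) = -1 := by
  ext i j
  fin_cases i <;> fin_cases j <;> simp [skew, mul_apply]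

theorem mul_self_of_trace_of_det {Q : Matrix (Fin 2) (Fin 2) ℂ} (ht : Q.trace = 0)
    (hd : Q.det = 1) : Q * Q = -1 := by
  rw [trace_fin_two] at ht
  rw [det_fin_two] at hd
  have h : Q 1 1 = -Q 0 0 := by linear_combination ht
  rw [h] at hd
  ext i j
  fin_cases i <;> fin_cases j <;> simp [mul_apply, Fin.sum_univ_two, h] <;>
    first | ring1 | linear_combination -hd

theorem mul_eq_neg_mul_of_trace {P Q : Matrix (Fin 2) (Fin 2) ℂ} (hP : P.trace = 0)
    (hQ : Q.trace = 0) (hPQ : (P * Q).trace = 0) : P * Q = -(Q * P) := by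
  rw [trace_fin_two] at hP hQ
  have h1 : P 1 1 = -P 0 0 := by linear_combination hP
  have h2 : Q 1 1 = -Q 0 0 := by linear_combination hQ
  simp only [trace_fin_two, mul_apply, Fin.sum_univ_two, h1, h2] at hPQ
  ext i j
  fin_cases i <;> fin_cases j <;> simp [mul_apply, Fin.sum_univ_two, h1, h2]
  · linear_combination hPQ
  · ring
  · ring
  · linear_combination hPQ

/-- Two anticommuting square roots of `-1` are simultaneously similar to two unit quaternions. -/
theorem exists_quaternion_basis {P Q : Matrix (Fin 2) (Fin 2) ℂ} (hPt : P.trace = 0)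
    (hPd : P.det = 1) (hQ : Q * Q = -1) (hPQ : P * Q = -(Q * P)) :
    ∃ G : Matrix (Fin 2) (Fin 2) ℂ, G.det ≠ 0 ∧
      P * G = G * !![Complex.I, 0; 0, -Complex.I] ∧ Q * G = G * !![0, -1; 1, 0] := by
  have hdet : (P - Complex.I • (1 : Matrix (Fin 2) (Fin 2) ℂ)).det = 0 := by
    rw [trace_fin_two] at hPt
    rw [det_fin_two] at hPd
    simp [det_fin_two]
    linear_combination hPd - Complex.I * hPt + Complex.I_sq
  obtain ⟨u, hu, hPu⟩ := exists_mulVec_eq_zero_iff.mpr hdet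
  rw [sub_mulVec, smul_mulVec, one_mulVec, sub_eq_zero] at hPu
  -- the eigenvectors `u` and `Q u` of `P` have eigenvalues `I` and `-I`
  have hQQ : Q *ᵥ (Q *ᵥ u) = -u := by rw [mulVec_mulVec, hQ, neg_mulVec, one_mulVec]
  have hPQu : P *ᵥ (Q *ᵥ u) = -(Complex.I • (Q *ᵥ u)) := by
    rw [mulVec_mulVec, hPQ, neg_mulVec, ← mulVec_mulVec, hPu, mulVec_smul]
  have hQu : Q *ᵥ u ≠ 0 := by
    intro h
    rw [h, mulVec_zero] at hQQ
    exact hu (neg_eq_zero.mp hQQ.symm)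
  generalize hv : Q *ᵥ u = v at hQQ hPQu hQu
  refine ⟨(Matrix.of ![u, v])ᵀ, ?_, ?_, ?_⟩
  · rw [det_transpose]
    intro h
    obtain ⟨c, hc, hc0⟩ := exists_vecMul_eq_zero_iff.mpr h
    have hc1 : c 0 • u + c 1 • v = 0 := by
      rw [← hc0]
      ext i
      simp [vecMul, dotProduct, Fin.sum_univ_two]
    have hc2 : c 0 • u - c 1 • v = 0 := by
      have h := congrArg (fun v => (-Complex.I) • (P *ᵥ v)) hc1
      simp only [mulVec_add, mulVec_smul, hPu, hPQu, mulVec_zero, smul_zero] at h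
      rw [← h]
      ext i
      simp only [Pi.sub_apply, Pi.smul_apply, Pi.add_apply, Pi.neg_apply, smul_eq_mul]
      linear_combination (c 0 * u i - c 1 * v i) * Complex.I_sq
    have h0 : c 0 = 0 := by
      have : (2 * c 0) • u = 0 := by
        rw [two_mul, add_smul]
        linear_combination (exp := 1) hc1 + hc2
      simpa [hu] using this
    have h1 : c 1 = 0 := by
      rw [h0, zero_smul, zero_add] at hc1
      exact (smul_eq_zero.mp hc1).resolve_right hQu
    apply hc
    ext i
    fin_cases i
    · exact h0
    · exact h1
  · ext i j
    have e1 := congrFun hPu i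
    have e2 := congrFun hPQu i
    simp only [mulVec, dotProduct, Fin.sum_univ_two, Pi.smul_apply, Pi.neg_apply,
      smul_eq_mul] at e1 e2
    fin_cases j
    · simp [mul_apply, Fin.sum_univ_two]
      linear_combination e1
    · simp [mul_apply, Fin.sum_univ_two]
      linear_combination e2
  · ext i j
    have e1 := congrFun hv i
    have e2 := congrFun hQQ i
    simp only [mulVec, dotProduct, Fin.sum_univ_two, Pi.neg_apply] at e1 e2
    fin_cases j
    · simp [mul_apply, Fin.sum_univ_two]
      linear_combination e1
    · simp [mul_apply, Fin.sum_univ_two]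
      linear_combination e2

theorem conj_mul {l m n : Type*} [Fintype m] (A : Matrix l m ℂ) (B : Matrix m n ℂ) :
    (A * B).map (starRingEnd ℂ) = A.map (starRingEnd ℂ) * B.map (starRingEnd ℂ) :=
  Matrix.map_mul

theorem conj_conj {m n : Type*} (A : Matrix m n ℂ) :
    (A.map (starRingEnd ℂ)).map (starRingEnd ℂ) = A := by
  ext
  simp

/-- Three traceless matrices of determinant `1`, orthogonal to each other, are the images of the
imaginary units under an isomorphism from the complexified quaternions. The matrix `N` expresses
the corresponding quaternion conjugation. -/
theorem exists_conjugation {Q : Fin 3 → Matrix (Fin 2) (Fin 2) ℂ} (ht : ∀ j, (Q j).trace = 0)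
    (hd : ∀ j, (Q j).det = 1) (ho : ∀ i j, i ≠ j → (Q i * Q j).trace = 0) :
    ∃ N : Matrix (Fin 2) (Fin 2) ℂ, N * N.map (starRingEnd ℂ) = -1 ∧
      ∀ j, N * Q j = (Q j).map (starRingEnd ℂ) * N := by
  obtain ⟨G, hG, h0, h1⟩ := exists_quaternion_basis (ht 0) (hd 0)
    (mul_self_of_trace_of_det (ht 1) (hd 1))
    (mul_eq_neg_mul_of_trace (ht 0) (ht 1) (ho 0 1 (by decide)))
  have hGu : IsUnit G.det := isUnit_iff_ne_zero.mpr hG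
  have hGG : G * G⁻¹ = 1 := mul_nonsing_inv G hGu
  have hGG' : G⁻¹ * G = 1 := nonsing_inv_mul G hGu
  set S0 : Matrix (Fin 2) (Fin 2) ℂ := !![Complex.I, 0; 0, -Complex.I] with hS0
  set S1 : Matrix (Fin 2) (Fin 2) ℂ := !![0, -1; 1, 0] with hS1
  let S2 := G⁻¹ * Q 2 * G
  have h2 : Q 2 * G = G * S2 := by
    simp only [S2]
    rw [← Matrix.mul_assoc, ← Matrix.mul_assoc, hGG, Matrix.one_mul]
  have e0 : skew * S0 = S0.map (starRingEnd ℂ) * skew := by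
    ext i j
    fin_cases i <;> fin_cases j <;> simp [skew, S0, mul_apply, Fin.sum_univ_two]
  have e1 : skew * S1 = S1.map (starRingEnd ℂ) * skew := by
    ext i j
    fin_cases i <;> fin_cases j <;> simp [skew, S1, mul_apply, Fin.sum_univ_two]
  -- the orthogonality relations leave `± I • !![0, 1; 1, 0]` for the third matrix
  have e2 : skew * S2 = S2.map (starRingEnd ℂ) * skew := by
    have t : S2.trace = 0 := by
      simp only [S2]
      rw [trace_mul_comm, ← Matrix.mul_assoc, hGG, Matrix.one_mul, ht]
    have d : S2.det = 1 := by
      simp only [S2]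
      rw [det_mul, det_mul, hd, mul_one, ← det_mul, hGG', det_one]
    have tr : ∀ (j : Fin 3) (S : Matrix (Fin 2) (Fin 2) ℂ), j ≠ 2 → Q j * G = G * S →
        (S2 * S).trace = 0 := by
      intro j S hj hS
      simp only [S2]
      rw [Matrix.mul_assoc (G⁻¹ * Q 2), ← hS, Matrix.mul_assoc, trace_mul_comm, Matrix.mul_assoc,
        Matrix.mul_assoc, hGG, Matrix.mul_one, ho 2 j hj.symm]
    have t0 := tr 0 S0 (by decide) h0
    have t1 := tr 1 S1 (by decide) h1
    clear_value S2
    rw [trace_fin_two] at t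
    rw [det_fin_two] at d
    simp [trace_fin_two, mul_apply, Fin.sum_univ_two, hS0] at t0
    simp [trace_fin_two, mul_apply, Fin.sum_univ_two, hS1] at t1
    have a0 : S2 0 0 = 0 := by
      have : Complex.I * (2 * S2 0 0) = 0 := by linear_combination t0 + Complex.I * t
      simpa using this
    have a1 : S2 1 1 = 0 := by linear_combination t - a0
    have a2 : S2 1 0 = S2 0 1 := by linear_combination -t1
    have a3 : (starRingEnd ℂ) (S2 0 1) = -S2 0 1 := by
      rw [a0, a2] at d
      have : (S2 0 1 - Complex.I) * (S2 0 1 + Complex.I) = 0 := by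
        linear_combination -d - Complex.I_sq
      rcases mul_eq_zero.mp this with h | h
      · rw [sub_eq_zero.mp h, Complex.conj_I]
      · rw [eq_neg_of_add_eq_zero_left h, map_neg, Complex.conj_I]
    ext i j
    fin_cases i <;> fin_cases j <;>
      simp [skew, mul_apply, Fin.sum_univ_two, a0, a1, a2, a3]
  refine ⟨G.map (starRingEnd ℂ) * skew * G⁻¹, ?_, ?_⟩
  · have hGc : (G⁻¹).map (starRingEnd ℂ) * G.map (starRingEnd ℂ) = 1 := by
      rw [← conj_mul, hGG', Matrix.map_one _ (map_zero _) (map_one _)]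
    rw [conj_mul, conj_mul, conj_conj]
    calc G.map (starRingEnd ℂ) * skew * G⁻¹ *
          (G * skew.map (starRingEnd ℂ) * (G⁻¹).map (starRingEnd ℂ))
        = G.map (starRingEnd ℂ) * (skew * ((G⁻¹ * G) * skew.map (starRingEnd ℂ))) *
          (G⁻¹).map (starRingEnd ℂ) := by simp only [Matrix.mul_assoc]
      _ = -1 := by
        rw [hGG', Matrix.one_mul, skew_mul_map_conj, Matrix.mul_neg, Matrix.mul_one,
          Matrix.neg_mul, mul_eq_one_comm.mp hGc]
  · have main : ∀ (R S : Matrix (Fin 2) (Fin 2) ℂ), R * G = G * S →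
        skew * S = S.map (starRingEnd ℂ) * skew →
        G.map (starRingEnd ℂ) * skew * G⁻¹ * R =
          R.map (starRingEnd ℂ) * (G.map (starRingEnd ℂ) * skew * G⁻¹) := by
      intro R S hR hS
      have hR' : G⁻¹ * R = S * G⁻¹ := by
        calc G⁻¹ * R = G⁻¹ * (R * G) * G⁻¹ := by
              rw [Matrix.mul_assoc, Matrix.mul_assoc R, hGG, Matrix.mul_one]
          _ = S * G⁻¹ := by rw [hR, ← Matrix.mul_assoc, hGG', Matrix.one_mul]
      have hRc : R.map (starRingEnd ℂ) * G.map (starRingEnd ℂ) =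
          G.map (starRingEnd ℂ) * S.map (starRingEnd ℂ) := by
        rw [← conj_mul, hR, conj_mul]
      rw [Matrix.mul_assoc _ _ R, hR', ← Matrix.mul_assoc, Matrix.mul_assoc _ skew S, hS,
        ← Matrix.mul_assoc, ← hRc]
      simp only [Matrix.mul_assoc]
    intro j
    fin_cases j
    · exact main _ _ h0 e0
    · exact main _ _ h1 e1
    · exact main _ _ h2 e2

theorem trace_adjugate_mul_vecMat {κ : Type*} (V : Matrix (Fin 2 × Fin 2) κ ℂ) (k l : κ) :
    (adjugate (vecMat (V.col k)) * vecMat (V.col l)).trace = -(Vᵀ * spinFlip * V) k l := by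
  rw [spinFlip_form_apply, adjugate_fin_two, trace_fin_two, mul_apply, mul_apply]
  simp [vecMat, Fin.sum_univ_two]
  ring

theorem trace_mul_of_trace_eq_zero {X : Matrix (Fin 2) (Fin 2) ℂ} (hX : X.trace = 0)
    (Y : Matrix (Fin 2) (Fin 2) ℂ) : (X * Y).trace = -(adjugate X * Y).trace := by
  have h : adjugate X = -X := by
    rw [trace_fin_two] at hX
    rw [adjugate_fin_two]
    ext i j
    fin_cases i <;> fin_cases j <;> simp
    · linear_combination hX
    · linear_combination hX
  rw [h, Matrix.neg_mul, trace_neg, neg_neg]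

theorem ptForm_pureOp_conjTranspose {N B Q : Matrix (Fin 2) (Fin 2) ℂ} {ψ : Fin 2 × Fin 2 → ℂ}
    {r : ℝ} (h : B * vecMat ψ = (r : ℂ) • Q) :
    ptForm (N * B)ᴴ (pureOp ψ) = r ^ 2 * (N * Q * (N * Q).map (starRingEnd ℂ)).trace.re := by
  have hmap : ((r : ℂ) • (N * Q)).map (starRingEnd ℂ) =
      (r : ℂ) • (N * Q).map (starRingEnd ℂ) := by
    ext a b
    simp [-Matrix.map_mul]
  rw [ptForm_pureOp, conjTranspose_conjTranspose, Matrix.mul_assoc N, h, Matrix.mul_smul, hmap,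
    smul_mul, Matrix.mul_smul, smul_smul, trace_smul, smul_eq_mul, ← Complex.ofReal_mul,
    Complex.re_ofReal_mul, sq]

theorem mul_mul_conj_eq_one {N Q : Matrix (Fin 2) (Fin 2) ℂ}
    (hN : N * N.map (starRingEnd ℂ) = -1) (hNQ : N * Q = Q.map (starRingEnd ℂ) * N)
    (hQ : Q * Q = -1) : N * Q * (N * Q).map (starRingEnd ℂ) = 1 := by
  have h1 : Q.map (starRingEnd ℂ) * Q.map (starRingEnd ℂ) = -1 := by
    rw [← conj_mul, hQ]
    ext a b
    by_cases hab : a = b <;> simp [one_apply, hab]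
  calc N * Q * (N * Q).map (starRingEnd ℂ)
      = Q.map (starRingEnd ℂ) * (N * Q) * N.map (starRingEnd ℂ) := by
        rw [hNQ, conj_mul, conj_conj, ← hNQ]
        conv_lhs => rw [hNQ]
        simp only [Matrix.mul_assoc]
    _ = Q.map (starRingEnd ℂ) * Q.map (starRingEnd ℂ) * (N * N.map (starRingEnd ℂ)) := by
        rw [hNQ]
        simp only [Matrix.mul_assoc]
    _ = 1 := by rw [h1, hN, neg_mul_neg, Matrix.one_mul]

/-- The columns of a decomposition that is orthogonal for the spin-flip form are, up to an
invertible factor `A 0` on the left, the unit and three imaginary units of the complexified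
quaternions. In the vector `W` defined by the quaternion conjugation, the first column contributes
`-2 λ₁` and the others `2 λ_j`, up to a common factor. -/
theorem exists_witness_of_posDef {τ : Op} (hτ : τ.PosDef) (hL : 0 < Lam τ) :
    ∃ W : Matrix (Fin 2) (Fin 2) ℂ, W.det ≠ 0 ∧ ptForm W τ < 0 := by
  obtain ⟨V, hV, -, hpos, hd⟩ := exists_lam_decomposition_of_posDef hτ
  let A : Fin 4 → Matrix (Fin 2) (Fin 2) ℂ := fun j => vecMat (V.col j)
  have hAdet : ∀ j, (A j).det = -(lam τ j : ℂ) / 2 := by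
    intro j
    have h := spinFlip_form_self V j
    rw [hd, diagonal_apply_eq] at h
    rw [det_vecMat, h]
    ring
  have hA0 : (A 0).det ≠ 0 := by
    rw [hAdet]
    simpa using (hpos 0).ne'
  have hA0u : IsUnit (A 0).det := isUnit_iff_ne_zero.mpr hA0
  have horth : ∀ i j, i ≠ j → (adjugate (A i) * A j).trace = 0 := by
    intro i j hij
    rw [trace_adjugate_mul_vecMat, hd, diagonal_apply_ne _ hij, neg_zero]
  let r : Fin 4 → ℝ := fun j => √(lam τ j / lam τ 0)
  have hr : ∀ j, 0 < r j := fun j => Real.sqrt_pos.mpr (div_pos (hpos j) (hpos 0))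
  have hrc : ∀ j, (r j : ℂ) ≠ 0 := fun j => by exact_mod_cast (hr j).ne'
  have hr2 : ∀ j, r j ^ 2 = lam τ j / lam τ 0 :=
    fun j => Real.sq_sqrt (div_pos (hpos j) (hpos 0)).le
  let X : Fin 3 → Matrix (Fin 2) (Fin 2) ℂ := fun j => (A 0)⁻¹ * A j.succ
  let Q : Fin 3 → Matrix (Fin 2) (Fin 2) ℂ := fun j => (r j.succ : ℂ)⁻¹ • X j
  have hXt : ∀ j, (X j).trace = 0 := by
    intro j
    simp only [X]
    rw [inv_def, smul_mul, trace_smul, horth 0 j.succ (Fin.succ_ne_zero j).symm, smul_zero]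
  have hXo : ∀ i j, i ≠ j → (X i * X j).trace = 0 := by
    intro i j hij
    rw [trace_mul_of_trace_eq_zero (hXt i)]
    simp only [X]
    rw [adjugate_mul_distrib, Matrix.mul_assoc, ← Matrix.mul_assoc (adjugate (A 0)⁻¹), adjugate_mul,
      smul_mul, Matrix.one_mul, Matrix.mul_smul, trace_smul,
      horth _ _ ((Fin.succ_injective 3).ne hij), smul_zero, neg_zero]
  have hQd : ∀ j, (Q j).det = 1 := by
    intro j
    have h0 : (lam τ 0 : ℂ) ≠ 0 := by exact_mod_cast (hpos 0).ne'
    have hj : (lam τ j.succ : ℂ) ≠ 0 := by exact_mod_cast (hpos j.succ).ne'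
    have hc : (r j.succ : ℂ) ^ 2 = lam τ j.succ / lam τ 0 := by exact_mod_cast hr2 j.succ
    simp only [Q, X]
    rw [det_smul, det_mul, det_nonsing_inv, Ring.inverse_eq_inv', hAdet, hAdet, Fintype.card_fin,
      inv_pow, hc]
    field_simp
  obtain ⟨N, hN, hNQ⟩ := exists_conjugation (Q := Q)
    (fun j => by simp only [Q]; rw [trace_smul, hXt, smul_zero]) hQd
    (fun i j hij => by
      simp only [Q]
      rw [smul_mul, Matrix.mul_smul, trace_smul, trace_smul, hXo i j hij, smul_zero, smul_zero])
  have hQ2 : ∀ j, Q j * Q j = -1 := fun j => mul_self_of_trace_of_det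
    (by simp only [Q]; rw [trace_smul, hXt, smul_zero]) (hQd j)
  have hNdet : N.det ≠ 0 := by
    intro h
    have := congrArg det hN
    rw [det_mul, h, zero_mul] at this
    simp [det_fin_two] at this
  refine ⟨(N * (A 0)⁻¹)ᴴ, ?_, ?_⟩
  · rw [det_conjTranspose, det_mul, det_nonsing_inv, Ring.inverse_eq_inv']
    exact star_ne_zero.mpr (mul_ne_zero hNdet (inv_ne_zero hA0))
  have hfirst : ptForm (N * (A 0)⁻¹)ᴴ (pureOp (V.col 0)) = -2 := by
    rw [ptForm_pureOp_conjTranspose (r := 1) (Q := 1) (by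
      rw [Complex.ofReal_one, one_smul]; exact nonsing_inv_mul _ hA0u), Matrix.mul_one, hN]
    simp
  have hother : ∀ j : Fin 3, ptForm (N * (A 0)⁻¹)ᴴ (pureOp (V.col j.succ)) =
      2 * (lam τ j.succ / lam τ 0) := by
    intro j
    have hX : (A 0)⁻¹ * vecMat (V.col j.succ) = (r j.succ : ℂ) • Q j := by
      change X j = (r j.succ : ℂ) • ((r j.succ : ℂ)⁻¹ • X j)
      rw [smul_smul, mul_inv_cancel₀ (hrc _), one_smul]
    rw [ptForm_pureOp_conjTranspose hX, mul_mul_conj_eq_one hN (hNQ j) (hQ2 j), trace_one, hr2]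
    simp
    ring
  conv_lhs => rw [← hV, mul_conjTranspose_eq_sum, map_sum, Fin.sum_univ_succ]
  simp only [hfirst, hother, Fin.sum_univ_three]
  have h0 := hpos 0
  have hsum : (-2 : ℝ) + (2 * (lam τ 1 / lam τ 0) + 2 * (lam τ 2 / lam τ 0) +
      2 * (lam τ 3 / lam τ 0)) = -(2 / lam τ 0 * Lam τ) := by
    simp only [Lam]
    field_simp
    ring
  have : 0 < 2 / lam τ 0 * Lam τ := by positivity
  exact hsum.trans_lt (neg_lt_zero.mpr this)

/-- An operator of positive concurrence violates the positivity of the partial transpose. -/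
theorem exists_witness {τ : Op} (hτ : τ.PosSemidef) (hL : 0 < Lam τ) :
    ∃ W : Matrix (Fin 2) (Fin 2) ℂ, W.det ≠ 0 ∧ ptForm W τ < 0 := by
  obtain ⟨-, φ, -, -, -, -, -, hlim⟩ := exists_lam_decomposition_limit hτ
  have hi := tendsto_pi_nhds.mp hlim
  have hLlim := (((hi 0).sub (hi 1)).sub (hi 2)).sub (hi 3)
  obtain ⟨n, hn⟩ := (hLlim.eventually_const_lt hL).exists
  have hδ : (0 : ℝ) < 1 / ((φ n : ℝ) + 1) := by positivity
  obtain ⟨W, hW, hneg⟩ := exists_witness_of_posDef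
    (PosDef.posSemidef_add hτ (PosDef.one.smul hδ)) hn
  rw [map_add, map_smul, smul_eq_mul] at hneg
  exact ⟨W, hW, by linarith [mul_nonneg hδ.le (ptForm_one_nonneg W)]⟩

/-! ### Edge states -/

theorem isState_of_isSeparable {τ : Op} (hτ : IsSeparable τ) : IsState τ := by
  obtain ⟨n, p, A, B, hp, h1, hA, hB, rfl⟩ := hτ
  refine ⟨posSemidef_sum _ fun i _ => ((hA i).1.kronecker (hB i).1).smul (hp i), ?_⟩
  simp only [trace_sum, trace_smul, trace_kronecker, (hA _).2, (hB _).2, mul_one]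
  rw [← Finset.sum_smul, h1, one_smul]

theorem isState_mix {ι : Type*} [Fintype ι] {t : ℝ} (ht : 0 < t) {ρ σ : Matrix ι ι ℂ}
    (hρ : IsState ρ) (hσ : IsState σ) : IsState (mix t ρ σ) := by
  have h1 : 0 < 1 + t := by positivity
  refine ⟨(hρ.1.add (hσ.1.smul ht.le)).smul (inv_nonneg.mpr h1.le), ?_⟩
  rw [mix, trace_smul, trace_add, trace_smul, hρ.2, hσ.2, Complex.real_smul, Complex.real_smul,
    mul_one]
  have : (1 + (t : ℂ)) ≠ 0 := by exact_mod_cast h1.ne'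
  push_cast
  exact inv_mul_cancel₀ this

theorem ptForm_mix (W : Matrix (Fin 2) (Fin 2) ℂ) (t : ℝ) (ρ σ : Op) :
    ptForm W (mix t ρ σ) = (1 + t)⁻¹ * (ptForm W ρ + t * ptForm W σ) := by
  rw [mix, map_smul, map_add, map_smul, smul_eq_mul, smul_eq_mul]

theorem concurrence_nonneg (τ : Op) : 0 ≤ concurrence τ := le_max_right _ _

theorem concurrence_pos_of_isEntangled {τ : Op} (hτ : IsEntangled τ) : 0 < concurrence τ :=
  (concurrence_nonneg τ).lt_of_ne fun h =>
    hτ.2 (isSeparable_of_concurrence_eq_zero hτ.1 h.symm)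

theorem mixingCosts_nonneg {ρ : Op} {x : ℝ} (hx : x ∈ mixingCosts ρ) : 0 ≤ x := by
  obtain ⟨t, σ, ht, -, -, rfl⟩ := hx
  exact mul_nonneg ht.le (concurrence_nonneg σ)

/-- The negative entanglement vanishes if and only if the mixing costs are arbitrarily small. -/
theorem negativeEntanglement_eq_zero_iff (ρ : Op) :
    negativeEntanglement ρ = 0 ↔ ∀ δ : ℝ, 0 < δ → ∃ x ∈ mixingCosts ρ, x < δ := by
  rw [negativeEntanglement, EReal.neg_eq_zero_iff]
  constructor
  · intro h δ hδ
    have h1 : sInf ((fun x : ℝ => (x : EReal)) '' mixingCosts ρ) < (δ : EReal) := by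
      rw [h]
      exact_mod_cast hδ
    obtain ⟨-, ⟨x, hx, rfl⟩, hlt⟩ := sInf_lt_iff.mp h1
    exact ⟨x, hx, EReal.coe_lt_coe_iff.mp hlt⟩
  · intro h
    apply le_antisymm
    · refine le_of_forall_gt fun c hc => ?_
      obtain ⟨δ, hδ0, hδc⟩ := EReal.lt_iff_exists_real_btwn.mp hc
      obtain ⟨x, hx, hlt⟩ := h δ (by exact_mod_cast hδ0)
      refine (sInf_le (Set.mem_image_of_mem _ hx)).trans_lt (lt_trans ?_ hδc)
      exact_mod_cast hlt
    · refine le_sInf ?_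
      rintro - ⟨x, hx, rfl⟩
      exact EReal.coe_nonneg.mpr (mixingCosts_nonneg hx)

/-- If all mixtures of `ρ` with weight `ε` are separable, then the partial transpose of `ρ` is
positive with a margin proportional to the concurrence of the test vector. -/
theorem le_ptForm_of_forall_isSeparable {ρ : Op} {ε : ℝ} (hε : 0 < ε)
    (h : ∀ σ : Op, IsState σ → IsSeparable σ ∨ IsSeparable (mix ε ρ σ))
    {W : Matrix (Fin 2) (Fin 2) ℂ} (hW : W.det ≠ 0) : ε * ‖W.det‖ ≤ ptForm W ρ := by
  obtain ⟨σ, hσ, hσW⟩ := exists_state_ptForm_eq hW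
  rcases h σ hσ with h1 | h1
  · have h2 := ptForm_nonneg_of_isSeparable W h1
    rw [hσW] at h2
    have := norm_pos_iff.mpr hW
    linarith
  · have h2 := ptForm_nonneg_of_isSeparable W h1
    rw [ptForm_mix, hσW] at h2
    have h3 := nonneg_of_mul_nonneg_right h2 (inv_pos.mpr (by positivity : 0 < 1 + ε))
    linarith

end TwoQubit

theorem corollary1 (ρ : TwoQubit.Op) (hρ : TwoQubit.IsSeparable ρ) :
    TwoQubit.IsEdgeState ρ ↔ TwoQubit.negativeEntanglement ρ = 0 := by
  open TwoQubit in
  rw [negativeEntanglement_eq_zero_iff]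
  constructor
  · rintro ⟨-, h⟩ δ hδ
    obtain ⟨σ, hσ, hmix⟩ := h (δ / 2) (by positivity)
    refine ⟨_, ⟨δ / 2, σ, by positivity, hσ, concurrence_pos_of_isEntangled hmix, rfl⟩, ?_⟩
    have := mul_le_mul_of_nonneg_left (concurrence_le_one hσ.1) (by positivity : 0 ≤ δ / 2)
    linarith
  · intro h
    refine ⟨hρ, ?_⟩
    by_contra! hne
    obtain ⟨ε, hε, hne⟩ := hne
    have hρs := isState_of_isSeparable hρ
    have hsep : ∀ σ : Op, IsState σ → IsSeparable σ ∨ IsSeparable (mix ε ρ σ) := by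
      intro σ hσ
      by_contra! hc
      exact hne σ ⟨hσ, hc.1⟩ ⟨isState_mix hε hρs hσ, hc.2⟩
    obtain ⟨-, ⟨t, σ, ht, hσ, hC, rfl⟩, hlt⟩ := h ε hε
    have hL : 0 < Lam (mix t ρ σ) := (lt_max_iff.mp hC).resolve_right (lt_irrefl 0)
    obtain ⟨W, hW, hneg⟩ := exists_witness (isState_mix ht hρs hσ.1).1 hL
    have h1 := le_ptForm_of_forall_isSeparable hε hsep hW
    have h2 := mul_le_mul_of_nonneg_left (neg_le_ptForm W hσ.1.1) ht.le
    have h3 := mul_le_mul_of_nonneg_left hlt.le (norm_nonneg W.det)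
    rw [ptForm_mix] at hneg
    have h4 := neg_of_mul_neg_right hneg (inv_nonneg.mpr (by positivity : 0 ≤ 1 + t))
    nlinarith
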